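/- Let $A\in\mathbb R^{n\times n}$ have all its eigenvalues in the open unit disc, let $B\in\mathbb R^{n\times m}$ have full column rank, let $(A,B)$ be reachable, i.e. $\operatorname{rank}[B,AB,\dots,A^{n-1}B]=n$, and put $G(z)=z(zI-A)^{-1}B$. Write $\int$ for $\int_{-\pi}^{\pi}\frac{d\theta}{2\pi}$ over the unit circle $z=e^{i\theta}$. A spectral density is an integrable function $\Phi$ on the unit circle with values in the $m\times m$ Hermitian matrices, positive definite almost everywhere, with finite $\int\log\det\Phi$; functions that agree almost everywhere are identified. For spectral densities $\Phi,\Psi$ let $$\mathbb D(\Phi\|\Psi)=\tfrac12\int \operatorname{tr}\bigl(\Phi\Psi^{-1}-\log\Phi+\log\Psi-I\bigr)\in[0,\infty].$$ Let $\Sigma$ be a real symmetric positive definite $n\times n$ matrix in the range of $\Gamma:\Phi\mapsto\int G\Phi G^*$ on integrable $m\times m$ matrix functions, and set $$\hat\Phi=(G^*\hat\Lambda G)^{-1},\qquad \hat\Lambda=\Sigma^{-1}B(B'\Sigma^{-1}B)^{-1}B'\Sigma^{-1}.$$ Then $\hat\Phi$ is a spectral density with $\int G\hat\Phi G^*=\Sigma$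 and $\hat\Phi(e^{-i\theta})=\overline{\hat\Phi(e^{i\theta})}$ for all $\theta$, and the following hold. (i) For every $n\times n$ matrix $\Lambda_0$ such that $\Psi=(G^*\Lambda_0G)^{-1}$ is a spectral density, $\hat\Phi$ is the unique minimizer of $\mathbb D(\Phi\|\Psi)$ over all spectral densities $\Phi$ with $\int G\Phi G^*=\Sigma$, and $\mathbb D(\hat\Phi\|\Psi)<\infty$. In particular the solution does not depend on $\Lambda_0$. (ii) If $m=1$, $A$ is the matrix with ones on the first subdiagonal and zeros elsewhere, and $B=(1,0,\dots,0)'$ (so that $G(z)=(1,z^{-1},\dots,z^{-(n-1)})'$), then $\hat\Phi$ is the density of a stable autoregressive model of order at most $n-1$, i.e. $\hat\Phi(e^{i\theta})=s/|a(e^{i\theta})|^2$ with $s>0$ and $a(z)=1+a_1z^{-1}+\dots+a_{n-1}z^{-(n-1)}$ real and without zeros in $|z|\ge1$, and $\hat\Phi$ is the unique maximizer of $\int\log\Phi$ over all spectral densities $\Phi$ with $\int G\Phi G^*=\Sigma$. -/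

import Mathlib

open scoped ComplexOrder

noncomputable section

namespace SpectralMoment

open MeasureTheory

/-- The normalized Lebesgue measure `dθ / 2π` on `(-π, π]`. -/
def circleMeasure : Measure ℝ :=
  ENNReal.ofReal (2 * Real.pi)⁻¹ • volume.restrict (Set.Ioc (-Real.pi) Real.pi)

/-- Matrix-valued functions on the unit circle, written as functions of the angle `θ`. Only the
values on `(-π, π]`, up to null sets, matter. -/
abbrev CircleFun (m : ℕ) : Type := ℝ → Matrix (Fin m) (Fin m) ℂ

/-- Entrywise integrability on the unit circle. -/
def IsIntegrable {m : ℕ} (Φ : CircleFun m) : Prop :=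
  ∀ i j, Integrable (fun θ => Φ θ i j) circleMeasure

/-- Power spectral density of an `m`-dimensional nondeterministic stationary process: an integrable
function on the unit circle whose values are Hermitian positive definite almost everywhere, and
whose entropy rate `∫ log det Φ` is finite. Densities of real-valued processes have in addition
the symmetry `HasRealSymmetry` below; it is not required here, so that a minimizer over all
spectral densities that has the symmetry is also the minimizer among the densities of real-valued
processes. -/
structure IsSpectralDensity {m : ℕ} (Φ : CircleFun m) : Prop where
  integrable : IsIntegrable Φ
  posDef : ∀ᵐ θ ∂circleMeasure, (Φ θ).PosDef
  entropy : Integrable (fun θ => Real.log (Φ θ).det.re) circleMeasure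

/-- `Φ(e^{-iθ})` is the entrywise complex conjugate of `Φ(e^{iθ})`: the symmetry of the spectral
densities of real-valued processes. -/
def HasRealSymmetry {m : ℕ} (Φ : CircleFun m) : Prop :=
  ∀ θ, Φ (-θ) = (Φ θ).map (starRingEnd ℂ)

/-- The entropy rate `∫ log det Φ`. -/
def entropyRate {m : ℕ} (Φ : CircleFun m) : ℝ :=
  ∫ θ, Real.log (Φ θ).det.re ∂circleMeasure

/-- The matrix logarithm (used for Hermitian positive definite matrices only). -/
def matrixLog {m : ℕ} (M : Matrix (Fin m) (Fin m) ℂ) : Matrix (Fin m) (Fin m) ℂ :=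
  cfc Real.log M

/-- The relative entropy (Kullback-Leibler divergence of the Gaussian laws, Itakura-Saito distance
of the densities) `(1/2) ∫ tr (Φ Ψ⁻¹ - log Φ + log Ψ - I)`. The integrand is nonnegative where `Φ`
and `Ψ` are positive definite, so the integral makes sense in `[0, ∞]`. -/
def relEntropy {m : ℕ} (Φ Ψ : CircleFun m) : ENNReal :=
  ∫⁻ θ, ENNReal.ofReal
    (1 / 2 * (Φ θ * (Ψ θ)⁻¹ - matrixLog (Φ θ) + matrixLog (Ψ θ) - 1).trace.re) ∂circleMeasure

/-- A real matrix viewed as a complex one. -/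
abbrev toC {k l : ℕ} (M : Matrix (Fin k) (Fin l) ℝ) : Matrix (Fin k) (Fin l) ℂ :=
  M.map (fun x : ℝ => (x : ℂ))

/-- All eigenvalues of `A` lie in the open unit disc. -/
def IsStable {n : ℕ} (A : Matrix (Fin n) (Fin n) ℝ) : Prop :=
  ∀ z ∈ spectrum ℂ (toC A), ‖z‖ < 1

/-- The matrix `[B, AB, …, A^{n-1}B]`. -/
def reachabilityMatrix {n m : ℕ} (A : Matrix (Fin n) (Fin n) ℝ) (B : Matrix (Fin n) (Fin m) ℝ) :
    Matrix (Fin n) (Fin n × Fin m) ℝ :=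
  Matrix.of fun i p => (A ^ (p.1 : ℕ) * B) i p.2

/-- The pair `(A, B)` is reachable. -/
def IsReachable {n m : ℕ} (A : Matrix (Fin n) (Fin n) ℝ) (B : Matrix (Fin n) (Fin m) ℝ) : Prop :=
  (reachabilityMatrix A B).rank = n

/-- The transfer function `G(z) = z (zI - A)⁻¹ B`. -/
def transfer {n m : ℕ} (A : Matrix (Fin n) (Fin n) ℝ) (B : Matrix (Fin n) (Fin m) ℝ) (z : ℂ) :
    Matrix (Fin n) (Fin m) ℂ :=
  z • ((z • (1 : Matrix (Fin n) (Fin n) ℂ) - toC A)⁻¹ * toC B)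

/-- `G(e^{iθ})`. -/
def circleTransfer {n m : ℕ} (A : Matrix (Fin n) (Fin n) ℝ) (B : Matrix (Fin n) (Fin m) ℝ) (θ : ℝ) :
    Matrix (Fin n) (Fin m) ℂ :=
  transfer A B (Complex.exp (θ * Complex.I))

/-- The operator `Γ : Φ ↦ ∫ G Φ G*`. -/
def Gam {n m : ℕ} (A : Matrix (Fin n) (Fin n) ℝ) (B : Matrix (Fin n) (Fin m) ℝ)
    (Φ : CircleFun m) : Matrix (Fin n) (Fin n) ℂ :=
  Matrix.of fun i j =>
    ∫ θ, (circleTransfer A B θ * Φ θ * (circleTransfer A B θ).conjTranspose) i j ∂circleMeasure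

/-- The real symmetric matrices in the range of `Γ` on integrable functions. -/
def rangeGam {n m : ℕ} (A : Matrix (Fin n) (Fin n) ℝ) (B : Matrix (Fin n) (Fin m) ℝ) :
    Set (Matrix (Fin n) (Fin n) ℝ) :=
  {S | S.IsSymm ∧ ∃ Φ : CircleFun m, IsIntegrable Φ ∧ Gam A B Φ = toC S}

/-- The spectral densities `Φ` with `∫ G Φ G* = S`. -/
def feasible {n m : ℕ} (A : Matrix (Fin n) (Fin n) ℝ) (B : Matrix (Fin n) (Fin m) ℝ)
    (S : Matrix (Fin n) (Fin n) ℝ) : Set (CircleFun m) :=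
  {Φ | IsSpectralDensity Φ ∧ Gam A B Φ = toC S}

/-- The minimizers of the relative entropy to the prior `Ψ` among the spectral densities `Φ`
with `∫ G Φ G* = S`. -/
def solutions {n m : ℕ} (A : Matrix (Fin n) (Fin n) ℝ) (B : Matrix (Fin n) (Fin m) ℝ)
    (S : Matrix (Fin n) (Fin n) ℝ) (Ψ : CircleFun m) : Set (CircleFun m) :=
  {Φ | Φ ∈ feasible A B S ∧ IsMinOn (fun Φ' => relEntropy Φ' Ψ) (feasible A B S) Φ}

/-- `(G* Λ G)⁻¹` on the unit circle. -/
def invQuad {n m : ℕ} (A : Matrix (Fin n) (Fin n) ℝ) (B : Matrix (Fin n) (Fin m) ℝ)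
    (L : Matrix (Fin n) (Fin n) ℂ) : CircleFun m :=
  fun θ => ((circleTransfer A B θ).conjTranspose * L * circleTransfer A B θ)⁻¹

/-- `Σ⁻¹ B (B' Σ⁻¹ B)⁻¹ B' Σ⁻¹`. -/
def lamHat {n m : ℕ} (B : Matrix (Fin n) (Fin m) ℝ) (S : Matrix (Fin n) (Fin n) ℝ) :
    Matrix (Fin n) (Fin n) ℝ :=
  S⁻¹ * B * (B.transpose * S⁻¹ * B)⁻¹ * B.transpose * S⁻¹

/-- `(G* Λ̂ G)⁻¹`. -/
def phiHat {n m : ℕ} (A : Matrix (Fin n) (Fin n) ℝ) (B : Matrix (Fin n) (Fin m) ℝ)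
    (S : Matrix (Fin n) (Fin n) ℝ) : CircleFun m :=
  invQuad A B (toC (lamHat B S))

/-- The scalar (`m = 1`) Fourier filter bank `G_k(z) = z^{-k}`, `k = 0, …, n - 1`: `A` has ones on
the first subdiagonal and zeros elsewhere, and `B` is the first unit vector. -/
def IsFourier {n m : ℕ} (A : Matrix (Fin n) (Fin n) ℝ) (B : Matrix (Fin n) (Fin m) ℝ) : Prop :=
  m = 1 ∧ (∀ i j, A i j = if (i : ℕ) = (j : ℕ) + 1 then 1 else 0) ∧
    ∀ i j, B i j = if (i : ℕ) = 0 then 1 else 0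

/-- The density (`m = 1`) of a stable autoregressive model with `p` coefficients, i.e. of order at
most `p - 1`: `Φ = s / |a(e^{iθ})|²` with `s > 0`, where `a(z) = 1 + a₁ z⁻¹ + … + a_{p-1} z^{-(p-1)}`
is real and has no zero with `|z| ≥ 1`. -/
def IsAutoregressive {m : ℕ} (p : ℕ) (Φ : CircleFun m) : Prop :=
  ∃ (s : ℝ) (a : ℕ → ℝ), 0 < s ∧ a 0 = 1 ∧
    (∀ z : ℂ, 1 ≤ ‖z‖ → ∑ k ∈ Finset.range p, (a k : ℂ) * (z ^ k)⁻¹ ≠ 0) ∧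
    ∀ θ i j, Φ θ i j =
      ((s / ‖∑ k ∈ Finset.range p, (a k : ℂ) * (Complex.exp (θ * Complex.I) ^ k)⁻¹‖ ^ 2 : ℝ) : ℂ)

end SpectralMoment

end

/-! If `Ψ⁻¹ = G* Λ₀ G`, cyclicity of the trace gives `∫ tr (Φ Ψ⁻¹) = tr (Λ₀ Σ)`, the same for all
feasible `Φ`. The divergence on the feasible set is therefore a constant minus half the entropy
rate: every such prior poses the same maximum entropy problem (`integral_divergence`,
`relEntropy_le_iff`). Taking the candidate itself as prior, twice the divergence of a feasible `Φ`
equals `entropyRate (phiHat A B S) - entropyRate Φ`. It is nonnegative and vanishes only for `Φ =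
phiHat` almost everywhere, by `divergence_nonneg`.

The harder half is feasibility. Write `M = B' Σ⁻¹ B`, `C = B' Σ⁻¹ G` and `P = I - B M⁻¹ B' Σ⁻¹`, a
projection with `P B = 0`. Membership in the range of `Γ` gives `Σ - A Σ A' = B K₁ + K₂ B'`
(`exists_displacement`), which `P` annihilates by congruence. Hence `F = P A` satisfies `Σ - F Σ F*
= B M⁻¹ B'` (`lyapunov_closedLoop`), and `F` inherits stability from `A` (`stable_closedLoop`).
Since `(I - z⁻¹ F) G = B M⁻¹ C`, the factor `C` is invertible for `|z| ≥ 1`, and `G Φ̂ G* = W B M⁻¹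
B' W*` with `W = (I - z⁻¹ F)⁻¹`, whose mean solves the Lyapunov equation and is `Σ` (`Gam_phiHat`).
For the Fourier bank `C` is a scalar polynomial in `z⁻¹`, and its invertibility is the stability of
the autoregressive model. -/

open scoped ComplexOrder

noncomputable section

namespace SpectralMoment

open MeasureTheory Matrix

/-! ### Pointwise divergence of positive definite matrices -/

section Divergence

variable {k : Type*} [Fintype k] [DecidableEq k]

/-- For a positive definite `X` the defect `tr X - log det X - k` is nonnegative. -/
lemma trace_sub_log_det_nonneg {X : Matrix k k ℂ} (hX : X.PosDef) :
    0 ≤ X.trace.re - Real.log X.det.re - Fintype.card k ∧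
      (X.trace.re - Real.log X.det.re - Fintype.card k = 0 → X = 1) := by
  have hpos := hX.eigenvalues_pos
  have htr : X.trace.re = ∑ i, hX.1.eigenvalues i := by
    rw [hX.1.trace_eq_sum_eigenvalues]; simp
  have hdet : X.det.re = ∏ i, hX.1.eigenvalues i := by
    rw [hX.1.det_eq_prod_eigenvalues, ← RCLike.ofReal_prod]; exact Complex.ofReal_re _
  -- Each eigenvalue `x` contributes `x - 1 - log x`, which is nonnegative and zero only at `x = 1`.
  have hsum : X.trace.re - Real.log X.det.re - Fintype.card k =
      ∑ i, (hX.1.eigenvalues i - 1 - Real.log (hX.1.eigenvalues i)) := by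
    rw [htr, hdet, Real.log_prod fun i _ => (hpos i).ne']
    simp only [Finset.sum_sub_distrib, Finset.sum_const, Finset.card_univ, nsmul_eq_mul, mul_one]
    ring
  have hnn : ∀ i ∈ Finset.univ,
      0 ≤ hX.1.eigenvalues i - 1 - Real.log (hX.1.eigenvalues i) := fun i _ => by
    linarith [Real.log_le_sub_one_of_pos (hpos i)]
  rw [hsum]
  refine ⟨Finset.sum_nonneg hnn, fun h => ?_⟩
  have h1 : hX.1.eigenvalues = 1 := funext fun i => by
    have hi := (Finset.sum_eq_zero_iff_of_nonneg hnn).1 h i (Finset.mem_univ i)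
    by_contra hne
    have := Real.log_lt_sub_one_of_pos (hpos i) hne
    linarith
  rw [hX.1.spectral_theorem, h1]
  have : (RCLike.ofReal ∘ (1 : k → ℝ) : k → ℂ) = 1 := by ext; simp
  rw [this]
  simp [-Unitary.conjStarAlgAut_apply]

lemma exists_isUnit_conjTranspose_mul_self {P : Matrix k k ℂ} (hP : P.PosDef) :
    ∃ R : Matrix k k ℂ, IsUnit R ∧ P = Rᴴ * R := by
  open scoped MatrixOrder in
  obtain ⟨R, hR⟩ := CStarAlgebra.nonneg_iff_eq_star_mul_self.mp hP.posSemidef.nonneg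
  refine ⟨R, ?_, hR⟩
  have h := hP.isUnit
  rw [hR, Matrix.isUnit_iff_isUnit_det, det_mul] at h
  rw [Matrix.isUnit_iff_isUnit_det]
  exact isUnit_of_mul_isUnit_right h

/-- The Itakura-Saito divergence of positive definite matrices is nonnegative and separates
points. -/
lemma divergence_nonneg {P Q : Matrix k k ℂ} (hP : P.PosDef) (hQ : Q.PosDef) :
    0 ≤ (P * Q⁻¹).trace.re - Real.log P.det.re + Real.log Q.det.re - Fintype.card k ∧
      ((P * Q⁻¹).trace.re - Real.log P.det.re + Real.log Q.det.re - Fintype.card k = 0 →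
        P = Q) := by
  obtain ⟨R, hR, hQR⟩ := exists_isUnit_conjTranspose_mul_self hQ.inv
  -- `P Q⁻¹` need not be Hermitian; the congruent matrix `R P R*`, with `Q⁻¹ = R* R`, is, and has
  -- the same trace and determinant.
  have hX : (R * P * Rᴴ).PosDef := (IsUnit.posDef_star_right_conjugate_iff hR).2 hP
  have htr : (R * P * Rᴴ).trace = (P * Q⁻¹).trace := by
    rw [hQR, Matrix.mul_assoc, trace_mul_comm, Matrix.mul_assoc]
  have hdet : (R * P * Rᴴ).det = P.det * (Q.det)⁻¹ := by
    have : (Q.det)⁻¹ = R.det * Rᴴ.det := by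
      rw [← Ring.inverse_eq_inv', ← det_nonsing_inv, hQR, det_mul, mul_comm]
    rw [det_mul, det_mul, this]; ring
  have hPd := hP.det_pos
  have hQd := hQ.det_pos
  rw [Complex.pos_iff] at hPd hQd
  have hPr : P.det = (P.det.re : ℂ) := Complex.ext rfl (by simp [hPd.2])
  have hQr : Q.det = (Q.det.re : ℂ) := Complex.ext rfl (by simp [hQd.2])
  have hlog : Real.log (R * P * Rᴴ).det.re = Real.log P.det.re - Real.log Q.det.re := by
    rw [hdet, hPr, hQr, ← Complex.ofReal_inv, ← Complex.ofReal_mul, Complex.ofReal_re,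
      Complex.ofReal_re, Complex.ofReal_re, Real.log_mul hPd.1.ne' (inv_ne_zero hQd.1.ne'),
      Real.log_inv]
    ring
  obtain ⟨h0, h1⟩ := trace_sub_log_det_nonneg hX
  rw [htr, hlog] at h0 h1
  refine ⟨by linarith, fun h => ?_⟩
  have hX1 := h1 (by linarith)
  have hRd := (Matrix.isUnit_iff_isUnit_det _).1 hR
  have h2 : R * (P * Rᴴ) = 1 := by rw [← Matrix.mul_assoc, hX1]
  have h3 : P * (Rᴴ * R) = 1 := by rw [← Matrix.mul_assoc]; exact mul_eq_one_comm.1 h2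
  rw [← hQR] at h3
  have hQu := (Matrix.isUnit_iff_isUnit_det _).1 hQ.isUnit
  calc P = P * Q⁻¹ * Q := by rw [Matrix.mul_assoc, nonsing_inv_mul _ hQu, Matrix.mul_one]
    _ = Q := by rw [h3, Matrix.one_mul]

end Divergence

/-- The functional calculus is a unitary conjugate of the diagonal of `log` of the eigenvalues, and
the trace does not see the conjugation. -/
lemma trace_matrixLog {m : ℕ} {P : Matrix (Fin m) (Fin m) ℂ} (hP : P.PosDef) :
    (matrixLog P).trace.re = Real.log P.det.re := by
  have hdet : P.det.re = ∏ i, hP.1.eigenvalues i := by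
    rw [hP.1.det_eq_prod_eigenvalues, ← RCLike.ofReal_prod]; exact Complex.ofReal_re _
  rw [matrixLog, hP.1.cfc_eq, IsHermitian.cfc, Unitary.conjStarAlgAut_apply, trace_mul_comm,
    ← Matrix.mul_assoc, Unitary.coe_star_mul_self, Matrix.one_mul, trace_diagonal, hdet,
    Real.log_prod fun i _ => (hP.eigenvalues_pos i).ne']
  simp

/-! ### Passing from real to complex matrices -/

section RealToComplex

variable {k l j : ℕ}

lemma toC_mul (M : Matrix (Fin k) (Fin l) ℝ) (N : Matrix (Fin l) (Fin j) ℝ) :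
    toC (M * N) = toC M * toC N :=
  Matrix.map_mul (f := Complex.ofRealHom)

lemma toC_one : toC (1 : Matrix (Fin k) (Fin k) ℝ) = 1 := by
  simp [toC]

lemma toC_transpose (M : Matrix (Fin k) (Fin l) ℝ) : toC Mᵀ = (toC M)ᴴ := by
  ext i j; simp

lemma toC_map_conj (M : Matrix (Fin k) (Fin l) ℝ) :
    (toC M).map (starRingEnd ℂ) = toC M := by
  ext i j; simp

lemma toC_inv {M : Matrix (Fin k) (Fin k) ℝ} (hM : IsUnit M) : toC M⁻¹ = (toC M)⁻¹ := by
  refine (Matrix.inv_eq_left_inv ?_).symm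
  rw [← toC_mul, nonsing_inv_mul _ ((Matrix.isUnit_iff_isUnit_det _).1 hM), toC_one]

lemma toC_posDef {M : Matrix (Fin k) (Fin k) ℝ} (hM : M.PosDef) : (toC M).PosDef := by
  have hsymm : ∀ x y, M x y = M y x := fun x y => by
    have := congrFun (congrFun hM.1 y) x
    simpa using this
  refine .of_dotProduct_mulVec_pos ?_ fun x hx => ?_
  · ext i j; simp [hsymm i j]
  · set u : Fin k → ℝ := fun i => (x i).re
    set v : Fin k → ℝ := fun i => (x i).im
    -- With `x = u + iv`, the cross terms cancel because `M` is symmetric.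
    have key : star x ⬝ᵥ (toC M *ᵥ x) = ((u ⬝ᵥ (M *ᵥ u) + v ⬝ᵥ (M *ᵥ v) : ℝ) : ℂ) := by
      have hx' : ∀ i, x i = (u i : ℂ) + (v i : ℂ) * Complex.I := fun i => (Complex.re_add_im _).symm
      have hs : (u ⬝ᵥ (M *ᵥ v) : ℝ) = v ⬝ᵥ (M *ᵥ u) := by
        simp only [dotProduct, mulVec, Finset.mul_sum]
        rw [Finset.sum_comm]
        refine Finset.sum_congr rfl fun i _ => Finset.sum_congr rfl fun j _ => ?_
        rw [hsymm j i]; ring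
      have e : star x ⬝ᵥ (toC M *ᵥ x) =
          ((u ⬝ᵥ (M *ᵥ u) : ℝ) : ℂ) + ((v ⬝ᵥ (M *ᵥ v) : ℝ) : ℂ) +
            (((u ⬝ᵥ (M *ᵥ v) : ℝ) : ℂ) - ((v ⬝ᵥ (M *ᵥ u) : ℝ) : ℂ)) * Complex.I := by
        simp only [dotProduct, mulVec, Finset.mul_sum, Pi.star_apply, Complex.ofReal_sum, toC,
          map_apply, ← Finset.sum_add_distrib, ← Finset.sum_sub_distrib, Finset.sum_mul]
        refine Finset.sum_congr rfl fun i _ => Finset.sum_congr rfl fun j _ => ?_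
        rw [hx' i, hx' j]
        simp only [star_add, star_mul', RCLike.star_def, Complex.conj_ofReal, Complex.conj_I,
          Complex.ofReal_mul]
        linear_combination (-(v i : ℂ) * M i j * v j) * Complex.I_sq
      rw [e, hs]; push_cast; ring
    rw [key, Complex.zero_lt_real]
    have hnn : ∀ w : Fin k → ℝ, 0 ≤ w ⬝ᵥ (M *ᵥ w) := fun w => by
      simpa using hM.posSemidef.dotProduct_mulVec_nonneg w
    have hp : ∀ w : Fin k → ℝ, w ≠ 0 → 0 < w ⬝ᵥ (M *ᵥ w) := fun w hw => by
      simpa using hM.dotProduct_mulVec_pos hw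
    by_cases hu : u = 0
    · have hv : v ≠ 0 := fun hv => hx <| funext fun i =>
        Complex.ext (congrFun hu i) (congrFun hv i)
      linarith [hnn u, hp v hv]
    · linarith [hnn v, hp u hu]

lemma mulVec_injective_of_rank {M : Matrix (Fin k) (Fin l) ℝ} (hM : M.rank = l) :
    Function.Injective M.mulVec := by
  have h : LinearMap.ker M.mulVecLin = ⊥ := by
    have := M.mulVecLin.finrank_range_add_finrank_ker
    rw [← Matrix.rank, hM, Module.finrank_fin_fun] at this
    exact Submodule.finrank_eq_zero.1 (by omega)
  exact LinearMap.ker_eq_bot.1 h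

end RealToComplex

/-! ### Integration over the unit circle -/

section CircleIntegral

instance : IsProbabilityMeasure circleMeasure := by
  refine ⟨?_⟩
  have h : (0 : ℝ) < 2 * Real.pi := by positivity
  rw [circleMeasure, Measure.smul_apply, Measure.restrict_apply_univ, Real.volume_Ioc,
    smul_eq_mul, ← ENNReal.ofReal_mul (by positivity)]
  rw [show (2 * Real.pi)⁻¹ * (Real.pi - -Real.pi) = 1 by field_simp; ring, ENNReal.ofReal_one]

lemma integral_circleMeasure {E : Type*} [NormedAddCommGroup E] [NormedSpace ℝ E] (f : ℝ → E) :
    ∫ θ, f θ ∂circleMeasure = (2 * Real.pi)⁻¹ • ∫ θ in (-Real.pi)..Real.pi, f θ := by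
  rw [circleMeasure, integral_smul_measure, ENNReal.toReal_ofReal (by positivity),
    intervalIntegral.integral_of_le (by linarith [Real.pi_pos])]

lemma ae_mem_Icc : ∀ᵐ θ ∂circleMeasure, θ ∈ Set.Icc (-Real.pi) Real.pi := by
  refine Measure.ae_smul_measure ?_ _
  filter_upwards [ae_restrict_mem measurableSet_Ioc] with θ hθ using Set.Ioc_subset_Icc_self hθ

lemma exists_ae_norm_le {f : ℝ → ℂ} (hf : Continuous f) :
    ∃ C, ∀ᵐ θ ∂circleMeasure, ‖f θ‖ ≤ C := by
  obtain ⟨C, hC⟩ := isCompact_Icc.exists_bound_of_continuousOn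
    (s := Set.Icc (-Real.pi) Real.pi) hf.continuousOn
  exact ⟨C, ae_mem_Icc.mono fun θ hθ => hC θ hθ⟩

/-- The mean value property, for the inverse boundary variable. -/
lemma integral_exp_inv {f : ℂ → ℂ} (hf : DiffContOnCl ℂ f (Metric.ball 0 1)) :
    ∫ θ : ℝ, f (Complex.exp (θ * Complex.I))⁻¹ ∂circleMeasure = f 0 := by
  have hper : Function.Periodic (fun θ : ℝ => f (circleMap 0 1 θ)) (2 * Real.pi) :=
    fun θ => by simp only [periodic_circleMap 0 1 θ]
  -- On the circle inversion is the reflection of the angle, which preserves the interval from `-π`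
  -- to `π`.
  have h1 : ∀ θ : ℝ, f (Complex.exp (θ * Complex.I))⁻¹ = f (circleMap 0 1 (-θ)) := fun θ => by
    rw [← Complex.exp_neg]; simp [circleMap]
  have h2 := hper.intervalIntegral_add_eq (-Real.pi) 0
  have e : -Real.pi + 2 * Real.pi = Real.pi := by ring
  rw [e, zero_add] at h2
  rw [integral_circleMeasure]
  simp_rw [h1]
  rw [intervalIntegral.integral_comp_neg (fun θ => f (circleMap 0 1 θ)), neg_neg, h2,
    ← Real.circleAverage_def]
  have := DiffContOnCl.circleAverage (f := f) (c := 0) (R := 1) (by simpa using hf)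
  exact this

end CircleIntegral

/-! ### Entrywise integrals of matrix functions -/

section MatrixIntegral

variable {k l j : ℕ}

/-- Entrywise integrability of a matrix function on the unit circle. -/
def EntryIntegrable (F : ℝ → Matrix (Fin k) (Fin l) ℂ) : Prop :=
  ∀ i j, Integrable (fun θ => F θ i j) circleMeasure

/-- The entrywise integral of a matrix function over the unit circle. -/
def matrixIntegral (F : ℝ → Matrix (Fin k) (Fin l) ℂ) : Matrix (Fin k) (Fin l) ℂ :=
  Matrix.of fun i j => ∫ θ, F θ i j ∂circleMeasure

lemma EntryIntegrable.sub {F G : ℝ → Matrix (Fin k) (Fin l) ℂ} (hF : EntryIntegrable F)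
    (hG : EntryIntegrable G) : EntryIntegrable fun θ => F θ - G θ :=
  fun i j => (hF i j).sub (hG i j)

lemma EntryIntegrable.continuous_mul {F : ℝ → Matrix (Fin j) (Fin k) ℂ}
    {G : ℝ → Matrix (Fin k) (Fin l) ℂ} (hF : Continuous F) (hG : EntryIntegrable G) :
    EntryIntegrable fun θ => F θ * G θ := fun i c => by
  simp only [mul_apply]
  refine integrable_finsetSum _ fun x _ => ?_
  have h := hF.matrix_elem i x
  obtain ⟨C, hC⟩ := exists_ae_norm_le h
  exact (hG x c).bdd_mul h.aestronglyMeasurable hC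

lemma EntryIntegrable.mul_continuous {F : ℝ → Matrix (Fin j) (Fin k) ℂ}
    {G : ℝ → Matrix (Fin k) (Fin l) ℂ} (hF : EntryIntegrable F) (hG : Continuous G) :
    EntryIntegrable fun θ => F θ * G θ := fun i c => by
  simp only [mul_apply]
  refine integrable_finsetSum _ fun x _ => ?_
  have h := hG.matrix_elem x c
  obtain ⟨C, hC⟩ := exists_ae_norm_le h
  exact (hF i x).mul_bdd h.aestronglyMeasurable hC

lemma EntryIntegrable.trace {F : ℝ → Matrix (Fin k) (Fin k) ℂ} (hF : EntryIntegrable F) :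
    Integrable (fun θ => (F θ).trace) circleMeasure :=
  integrable_finsetSum _ fun x _ => hF x x

lemma entryIntegrable_const (X : Matrix (Fin k) (Fin l) ℂ) : EntryIntegrable fun _ => X :=
  fun _ _ => integrable_const _

lemma entryIntegrable_of_continuous {F : ℝ → Matrix (Fin k) (Fin l) ℂ} (hF : Continuous F) :
    EntryIntegrable F := by
  simpa using (entryIntegrable_const (1 : Matrix (Fin l) (Fin l) ℂ)).continuous_mul hF

lemma matrixIntegral_const (X : Matrix (Fin k) (Fin l) ℂ) : matrixIntegral (fun _ => X) = X := by
  ext i j; simp [matrixIntegral]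

lemma matrixIntegral_add {F G : ℝ → Matrix (Fin k) (Fin l) ℂ} (hF : EntryIntegrable F)
    (hG : EntryIntegrable G) :
    matrixIntegral (fun θ => F θ + G θ) = matrixIntegral F + matrixIntegral G := by
  ext i j; exact integral_add (hF i j) (hG i j)

lemma matrixIntegral_sub {F G : ℝ → Matrix (Fin k) (Fin l) ℂ} (hF : EntryIntegrable F)
    (hG : EntryIntegrable G) :
    matrixIntegral (fun θ => F θ - G θ) = matrixIntegral F - matrixIntegral G := by
  ext i j; exact integral_sub (hF i j) (hG i j)

lemma matrixIntegral_const_mul (X : Matrix (Fin j) (Fin k) ℂ)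
    {F : ℝ → Matrix (Fin k) (Fin l) ℂ} (hF : EntryIntegrable F) :
    matrixIntegral (fun θ => X * F θ) = X * matrixIntegral F := by
  ext i c
  simp only [matrixIntegral, of_apply, mul_apply]
  rw [integral_finsetSum _ fun x _ => (hF x c).const_mul _]
  simp_rw [integral_const_mul]

lemma matrixIntegral_mul_const {F : ℝ → Matrix (Fin j) (Fin k) ℂ} (hF : EntryIntegrable F)
    (X : Matrix (Fin k) (Fin l) ℂ) :
    matrixIntegral (fun θ => F θ * X) = matrixIntegral F * X := by
  ext i c
  simp only [matrixIntegral, of_apply, mul_apply]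
  rw [integral_finsetSum _ fun x _ => (hF i x).mul_const _]
  simp_rw [integral_mul_const]

lemma matrixIntegral_conjTranspose (F : ℝ → Matrix (Fin k) (Fin l) ℂ) :
    matrixIntegral (fun θ => (F θ)ᴴ) = (matrixIntegral F)ᴴ := by
  ext i j
  simp only [matrixIntegral, of_apply, conjTranspose_apply, RCLike.star_def]
  exact integral_conj

lemma integral_trace {F : ℝ → Matrix (Fin k) (Fin k) ℂ} (hF : EntryIntegrable F) :
    ∫ θ, (F θ).trace ∂circleMeasure = (matrixIntegral F).trace := by
  simp only [Matrix.trace, diag_apply, matrixIntegral, of_apply]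
  exact integral_finsetSum _ fun x _ => hF x x

end MatrixIntegral

/-! ### Resolvents of stable matrices -/

section LinearSystem

variable {k : ℕ}

/-- For `w ≠ 0` the matrix is `w (w⁻¹ - a)`, and `w⁻¹` lies outside the open disc that contains the
spectrum. -/
lemma isUnit_one_sub_smul {a : Matrix (Fin k) (Fin k) ℂ} (ha : ∀ z ∈ spectrum ℂ a, ‖z‖ < 1)
    {w : ℂ} (hw : ‖w‖ ≤ 1) : IsUnit (1 - w • a) := by
  rcases eq_or_ne w 0 with rfl | h0
  · simp
  have h : w⁻¹ ∉ spectrum ℂ a := fun h => by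
    have := ha _ h
    rw [norm_inv] at this
    exact absurd this (not_lt.2 ((one_le_inv₀ (norm_pos_iff.2 h0)).2 hw))
  rw [spectrum.notMem_iff, Algebra.algebraMap_eq_smul_one] at h
  have := h.smul (Units.mk0 w h0)
  simpa [Units.smul_def, smul_sub, smul_smul, h0] using this

lemma det_one_sub_smul_ne_zero {a : Matrix (Fin k) (Fin k) ℂ}
    (ha : ∀ z ∈ spectrum ℂ a, ‖z‖ < 1) {w : ℂ} (hw : ‖w‖ ≤ 1) : (1 - w • a).det ≠ 0 :=
  ((Matrix.isUnit_iff_isUnit_det _).1 (isUnit_one_sub_smul ha hw)).ne_zero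

lemma norm_exp_inv (θ : ℝ) : ‖(Complex.exp (θ * Complex.I))⁻¹‖ = 1 := by
  rw [norm_inv, Complex.norm_exp_ofReal_mul_I, inv_one]

lemma continuous_exp_inv : Continuous fun θ : ℝ => (Complex.exp (θ * Complex.I))⁻¹ :=
  Continuous.inv₀ (by fun_prop) fun _ => Complex.exp_ne_zero _

/-- The resolvent `(I - z⁻¹ a)⁻¹` on the unit circle. -/
def resolventCircle (a : Matrix (Fin k) (Fin k) ℂ) (θ : ℝ) : Matrix (Fin k) (Fin k) ℂ :=
  (1 - (Complex.exp (θ * Complex.I))⁻¹ • a)⁻¹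

/-- Cramer's rule reduces continuity and holomorphy of an inverse to those of determinants. -/
lemma inv_eq_smul_adjugate (X : Matrix (Fin k) (Fin k) ℂ) : X⁻¹ = X.det⁻¹ • X.adjugate := by
  rw [Matrix.inv_def, Ring.inverse_eq_inv']

lemma continuous_inv_of_det_ne_zero {F : ℝ → Matrix (Fin k) (Fin k) ℂ} (hF : Continuous F)
    (h : ∀ θ, (F θ).det ≠ 0) : Continuous fun θ => (F θ)⁻¹ := by
  simp_rw [inv_eq_smul_adjugate]
  exact (hF.matrix_det.inv₀ h).smul hF.matrix_adjugate

lemma continuous_resolventCircle {a : Matrix (Fin k) (Fin k) ℂ}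
    (ha : ∀ z ∈ spectrum ℂ a, ‖z‖ < 1) : Continuous (resolventCircle a) :=
  continuous_inv_of_det_ne_zero (continuous_const.sub (continuous_exp_inv.smul continuous_const))
    fun θ => det_one_sub_smul_ne_zero ha (norm_exp_inv θ).le

lemma differentiable_det_entries {F : ℂ → Matrix (Fin k) (Fin k) ℂ}
    (hF : ∀ i j, Differentiable ℂ fun w => F w i j) : Differentiable ℂ fun w => (F w).det := by
  simp_rw [Matrix.det_apply]
  exact Differentiable.fun_sum fun σ _ =>
    (Differentiable.fun_finsetProd fun i _ => hF _ _).const_smul _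

/-- The mean of the resolvent is its value at infinity. -/
lemma matrixIntegral_resolventCircle {a : Matrix (Fin k) (Fin k) ℂ}
    (ha : ∀ z ∈ spectrum ℂ a, ‖z‖ < 1) : matrixIntegral (resolventCircle a) = 1 := by
  have hF : ∀ i j, Differentiable ℂ fun w : ℂ => (1 - w • a) i j := fun i j => by
    simp only [Matrix.sub_apply, Matrix.smul_apply, smul_eq_mul]; fun_prop
  ext i j
  have key : DiffContOnCl ℂ (fun w : ℂ => (1 - w • a)⁻¹ i j) (Metric.ball 0 1) := by
    refine DifferentiableOn.diffContOnCl ?_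
    rw [closure_ball _ one_ne_zero]
    intro w hw
    have hw' : ‖w‖ ≤ 1 := by simpa using hw
    have h1 := (differentiable_det_entries hF w).inv (det_one_sub_smul_ne_zero ha hw')
    have h2 : DifferentiableAt ℂ (fun w : ℂ => (1 - w • a).adjugate i j) w := by
      simp_rw [adjugate_apply]
      refine differentiable_det_entries (fun x y => ?_) w
      rcases eq_or_ne x j with rfl | hx
      · simp only [updateRow_self]; exact differentiable_const _
      · simp only [updateRow_ne hx]; exact hF x y
    simp_rw [inv_eq_smul_adjugate]
    exact (h1.mul h2).differentiableWithinAt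
  have := integral_exp_inv key
  simpa [matrixIntegral, resolventCircle] using this

end LinearSystem

/-! ### The closed-loop Lyapunov equation -/

section ClosedLoop

variable {n m : ℕ}

/-- The closed-loop matrix `(I - b M⁻¹ b* s⁻¹) a` with `M = b* s⁻¹ b`. -/
def closedLoop (a : Matrix (Fin n) (Fin n) ℂ) (b : Matrix (Fin n) (Fin m) ℂ)
    (s : Matrix (Fin n) (Fin n) ℂ) : Matrix (Fin n) (Fin n) ℂ :=
  (1 - b * (bᴴ * s⁻¹ * b)⁻¹ * bᴴ * s⁻¹) * a

variable {a s : Matrix (Fin n) (Fin n) ℂ} {b : Matrix (Fin n) (Fin m) ℂ}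

/-- The oblique projection in the closed-loop matrix annihilates the input directions. -/
lemma one_sub_mul_input_eq_zero (hM : (bᴴ * s⁻¹ * b).PosDef) :
    (1 - b * (bᴴ * s⁻¹ * b)⁻¹ * bᴴ * s⁻¹) * b = 0 := by
  have : b * (bᴴ * s⁻¹ * b)⁻¹ * bᴴ * s⁻¹ * b =
      b * ((bᴴ * s⁻¹ * b)⁻¹ * (bᴴ * s⁻¹ * b)) := by simp only [Matrix.mul_assoc]
  rw [Matrix.sub_mul, this, nonsing_inv_mul _ ((Matrix.isUnit_iff_isUnit_det _).1 hM.isUnit)]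
  simp

/-- The closed-loop Lyapunov equation. -/
lemma lyapunov_closedLoop (hs : s.PosDef) (hM : (bᴴ * s⁻¹ * b).PosDef)
    {K₁ : Matrix (Fin m) (Fin n) ℂ} {K₂ : Matrix (Fin n) (Fin m) ℂ}
    (h : s - a * s * aᴴ = b * K₁ + K₂ * bᴴ) :
    s - closedLoop a b s * s * (closedLoop a b s)ᴴ = b * (bᴴ * s⁻¹ * b)⁻¹ * bᴴ := by
  set M := bᴴ * s⁻¹ * b with hMdef
  set P : Matrix (Fin n) (Fin n) ℂ := 1 - b * M⁻¹ * bᴴ * s⁻¹ with hP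
  have hsu := (Matrix.isUnit_iff_isUnit_det _).1 hs.isUnit
  have hPH : Pᴴ = 1 - s⁻¹ * b * M⁻¹ * bᴴ := by
    rw [hP, conjTranspose_sub, conjTranspose_one, conjTranspose_mul, conjTranspose_mul,
      conjTranspose_mul, conjTranspose_conjTranspose, hs.inv.1.eq, hM.inv.1.eq]
    simp only [Matrix.mul_assoc]
  have hPb : P * b = 0 := one_sub_mul_input_eq_zero hM
  have hbP : bᴴ * Pᴴ = 0 := by rw [← conjTranspose_mul, hPb, conjTranspose_zero]
  have hPs : P * s = s - b * M⁻¹ * bᴴ := by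
    rw [hP, Matrix.sub_mul, Matrix.one_mul, Matrix.mul_assoc _ s⁻¹ s, nonsing_inv_mul _ hsu,
      Matrix.mul_one]
  have hPsP : P * s * Pᴴ = s - b * M⁻¹ * bᴴ := by
    rw [hPs, Matrix.sub_mul, Matrix.mul_assoc _ bᴴ, hbP, Matrix.mul_zero, sub_zero, hPH,
      Matrix.mul_sub, Matrix.mul_one]
    simp only [← Matrix.mul_assoc, mul_nonsing_inv _ hsu, Matrix.one_mul]
  -- One term of the displacement starts with `b`, the other ends with `bᴴ`: `P` kills the first
  -- from the left, `Pᴴ` the second from the right.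
  have h0 : P * (s - a * s * aᴴ) * Pᴴ = 0 := by
    rw [h, Matrix.mul_add, Matrix.add_mul, ← Matrix.mul_assoc, hPb, Matrix.zero_mul,
      Matrix.zero_mul, ← Matrix.mul_assoc, Matrix.mul_assoc _ bᴴ, hbP, Matrix.mul_zero, add_zero]
  have h1 : closedLoop a b s * s * (closedLoop a b s)ᴴ = P * (a * s * aᴴ) * Pᴴ := by
    rw [closedLoop, ← hMdef, ← hP, conjTranspose_mul]
    simp only [Matrix.mul_assoc]
  rw [Matrix.mul_sub, Matrix.sub_mul, sub_eq_zero] at h0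
  rw [h1, ← h0, hPsP, sub_sub_cancel]

/-- The closed loop inherits stability through its Lyapunov equation. -/
lemma stable_closedLoop (hs : s.PosDef) (hM : (bᴴ * s⁻¹ * b).PosDef)
    (ha : ∀ z ∈ spectrum ℂ a, ‖z‖ < 1)
    (h : s - closedLoop a b s * s * (closedLoop a b s)ᴴ = b * (bᴴ * s⁻¹ * b)⁻¹ * bᴴ) :
    ∀ z ∈ spectrum ℂ (closedLoop a b s), ‖z‖ < 1 := by
  intro z hz
  by_contra! hz1
  have hdet : (z • (1 : Matrix (Fin n) (Fin n) ℂ) - closedLoop a b s).det = 0 := by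
    rw [spectrum.mem_iff, Algebra.algebraMap_eq_smul_one, Matrix.isUnit_iff_isUnit_det,
      isUnit_iff_ne_zero, not_not] at hz
    exact hz
  -- A left eigenvector is needed: the Lyapunov equation tested against it reads `(1 - |z|²) x* s x
  -- = (b* x)* M⁻¹ (b* x)`, where `x = v*`.
  obtain ⟨v, hv, hvz⟩ := exists_vecMul_eq_zero_iff.2 hdet
  rw [vecMul_sub, vecMul_smul, vecMul_one, sub_eq_zero] at hvz
  set x := star v with hx
  have hxv : star x = v := star_star v
  have hx0 : x ≠ 0 := fun h0 => hv (by rw [← hxv, h0, star_zero])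
  have hxz : (closedLoop a b s)ᴴ *ᵥ x = star z • x := by
    rw [hx, ← star_vecMul, ← hvz, star_smul]
  have e1 : star x ⬝ᵥ ((s - closedLoop a b s * s * (closedLoop a b s)ᴴ) *ᵥ x) =
      (1 - z * star z) * (star x ⬝ᵥ (s *ᵥ x)) := by
    have e2 : star x ⬝ᵥ ((closedLoop a b s * s * (closedLoop a b s)ᴴ) *ᵥ x) =
        z * star z * (star x ⬝ᵥ (s *ᵥ x)) := by
      rw [← mulVec_mulVec, hxz, ← mulVec_mulVec, mulVec_smul, mulVec_smul, dotProduct_smul,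
        dotProduct_mulVec, hxv, ← hvz, smul_dotProduct, smul_eq_mul, smul_eq_mul]
      ring
    rw [sub_mulVec, dotProduct_sub, e2]; ring
  have e3 : star x ⬝ᵥ ((b * (bᴴ * s⁻¹ * b)⁻¹ * bᴴ) *ᵥ x) =
      star (bᴴ *ᵥ x) ⬝ᵥ ((bᴴ * s⁻¹ * b)⁻¹ *ᵥ (bᴴ *ᵥ x)) := by
    rw [← mulVec_mulVec, ← mulVec_mulVec, dotProduct_mulVec, star_mulVec,
      conjTranspose_conjTranspose]
  rw [h, e3] at e1
  have hpos := hs.dotProduct_mulVec_pos hx0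
  have hzz : z * star z = ((‖z‖ ^ 2 : ℝ) : ℂ) := by
    rw [RCLike.star_def, Complex.mul_conj, Complex.normSq_eq_norm_sq]
  have hle : (1 - z * star z) * (star x ⬝ᵥ (s *ᵥ x)) ≤ 0 := by
    refine mul_nonpos_of_nonpos_of_nonneg ?_ hpos.le
    rw [hzz, sub_nonpos]
    exact_mod_cast one_le_pow₀ hz1
  -- For `|z| ≥ 1` the left side is at most zero, while the right side is positive unless `b* x =
  -- 0`.
  have hbx : bᴴ *ᵥ x = 0 := by
    by_contra hne
    have := hM.inv.dotProduct_mulVec_pos hne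
    rw [e1] at this
    exact absurd this (not_lt_of_ge hle)
  have hvb : v ᵥ* b = 0 := by
    have := congrArg star hbx
    rwa [star_mulVec, conjTranspose_conjTranspose, hxv, star_zero] at this
  -- As `v b = 0`, the feedback term disappears and `v` is a left eigenvector of `a`, contradicting
  -- the stability of `a`.
  have hva : z • v = v ᵥ* a := by
    rw [hvz, closedLoop, Matrix.sub_mul, Matrix.one_mul, vecMul_sub]
    have : v ᵥ* (b * (bᴴ * s⁻¹ * b)⁻¹ * bᴴ * s⁻¹ * a) = 0 := by
      rw [← vecMul_vecMul, ← vecMul_vecMul, ← vecMul_vecMul, ← vecMul_vecMul, hvb]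
      simp only [zero_vecMul]
    rw [this, sub_zero]
  refine absurd (ha z ?_) (not_lt.2 hz1)
  rw [spectrum.mem_iff, Algebra.algebraMap_eq_smul_one, Matrix.isUnit_iff_isUnit_det,
    isUnit_iff_ne_zero, not_not]
  refine exists_vecMul_eq_zero_iff.1 ⟨v, hv, ?_⟩
  rw [vecMul_sub, vecMul_smul, vecMul_one, hva, sub_self]

/-- The stable Lyapunov equation is solved by the resolvent integral. -/
lemma matrixIntegral_resolventCircle_lyapunov {c q : Matrix (Fin n) (Fin n) ℂ}
    (hc : ∀ z ∈ spectrum ℂ c, ‖z‖ < 1) (h : s - c * s * cᴴ = q) :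
    matrixIntegral (fun θ => resolventCircle c θ * q * (resolventCircle c θ)ᴴ) = s := by
  -- Since `|w| = 1`, `q` splits so that each summand cancels one resolvent. What remains is affine
  -- in `W` and `W*`, both of mean `1`, so the integral is `s + (s - s)`.
  have key : ∀ θ, resolventCircle c θ * q * (resolventCircle c θ)ᴴ =
      s * (resolventCircle c θ)ᴴ + (resolventCircle c θ * s - s) := fun θ => by
    set w := (Complex.exp (θ * Complex.I))⁻¹ with hw
    have hww : w * star w = 1 := by
      rw [RCLike.star_def, Complex.mul_conj, Complex.normSq_eq_norm_sq, norm_exp_inv]; simp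
    set W := resolventCircle c θ with hW
    have hu := (Matrix.isUnit_iff_isUnit_det _).1 (isUnit_one_sub_smul hc (norm_exp_inv θ).le)
    have h1 : W * (1 - w • c) = 1 := nonsing_inv_mul _ hu
    have h2 : (1 - (w • c)ᴴ) * Wᴴ = 1 := by
      have := congrArg conjTranspose h1
      rwa [conjTranspose_mul, conjTranspose_sub, conjTranspose_one] at this
    have hq : q = (1 - w • c) * s + w • c * s * (1 - (w • c)ᴴ) := by
      have : w • c * s * (w • c)ᴴ = c * s * cᴴ := by
        rw [conjTranspose_smul, Matrix.smul_mul, Matrix.smul_mul, Matrix.mul_smul, smul_smul, hww,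
          one_smul]
      rw [← h, Matrix.sub_mul, Matrix.one_mul, Matrix.mul_sub, Matrix.mul_one, this]
      abel
    have h3 : W * (w • c) = W - 1 := by
      rw [Matrix.mul_sub, Matrix.mul_one] at h1
      rw [← h1]; abel
    rw [hq, Matrix.mul_add, Matrix.add_mul, ← Matrix.mul_assoc, h1, Matrix.one_mul,
      ← Matrix.mul_assoc, ← Matrix.mul_assoc, h3, Matrix.mul_assoc _ _ Wᴴ, h2, Matrix.mul_one,
      Matrix.sub_mul, Matrix.one_mul]
  have hi := entryIntegrable_of_continuous (continuous_resolventCircle hc)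
  have hiH := entryIntegrable_of_continuous
    ((continuous_resolventCircle hc).matrix_conjTranspose)
  simp_rw [key]
  rw [matrixIntegral_add ((entryIntegrable_const s).mul_continuous
      (continuous_resolventCircle hc).matrix_conjTranspose)
    ((hi.mul_continuous continuous_const).sub (entryIntegrable_const s)),
    matrixIntegral_sub (hi.mul_continuous continuous_const) (entryIntegrable_const s),
    matrixIntegral_const, matrixIntegral_const_mul _ hiH, matrixIntegral_mul_const hi,
    matrixIntegral_conjTranspose, matrixIntegral_resolventCircle hc]
  simp

end ClosedLoop

/-! ### The transfer function and the range of `Γ` -/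

section Transfer

variable {n m : ℕ} {A : Matrix (Fin n) (Fin n) ℝ} {B : Matrix (Fin n) (Fin m) ℝ}

lemma norm_inv_le_one {z : ℂ} (hz : 1 ≤ ‖z‖) : ‖z⁻¹‖ ≤ 1 := by
  rw [norm_inv]; exact inv_le_one_of_one_le₀ hz

lemma transfer_eq (hA : IsStable A) {z : ℂ} (hz : 1 ≤ ‖z‖) :
    transfer A B z = (1 - z⁻¹ • toC A)⁻¹ * toC B := by
  have hz0 : z ≠ 0 := by rintro rfl; norm_num at hz
  have hu := (Matrix.isUnit_iff_isUnit_det _).1 (isUnit_one_sub_smul hA (norm_inv_le_one hz))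
  have h : (z • (1 : Matrix (Fin n) (Fin n) ℂ) - toC A)⁻¹ = z⁻¹ • (1 - z⁻¹ • toC A)⁻¹ := by
    refine inv_eq_left_inv ?_
    have : z • (1 : Matrix (Fin n) (Fin n) ℂ) - toC A = z • (1 - z⁻¹ • toC A) := by
      rw [smul_sub, smul_smul, mul_inv_cancel₀ hz0, one_smul]
    rw [this, Matrix.smul_mul, Matrix.mul_smul, smul_smul, inv_mul_cancel₀ hz0, one_smul,
      nonsing_inv_mul _ hu]
  rw [transfer, h, Matrix.smul_mul, smul_smul, mul_inv_cancel₀ hz0, one_smul]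

lemma one_sub_smul_mul_transfer (hA : IsStable A) {z : ℂ} (hz : 1 ≤ ‖z‖) :
    (1 - z⁻¹ • toC A) * transfer A B z = toC B := by
  have hu := (Matrix.isUnit_iff_isUnit_det _).1 (isUnit_one_sub_smul hA (norm_inv_le_one hz))
  rw [transfer_eq hA hz, ← Matrix.mul_assoc, mul_nonsing_inv _ hu, Matrix.one_mul]

lemma circleTransfer_eq (hA : IsStable A) (θ : ℝ) :
    circleTransfer A B θ = resolventCircle (toC A) θ * toC B :=
  transfer_eq hA (Complex.norm_exp_ofReal_mul_I θ).ge

lemma continuous_circleTransfer (hA : IsStable A) : Continuous (circleTransfer A B) := by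
  rw [funext (circleTransfer_eq (B := B) hA)]
  exact (continuous_resolventCircle hA).matrix_mul continuous_const

lemma Gam_eq_matrixIntegral (Φ : CircleFun m) :
    Gam A B Φ =
      matrixIntegral fun θ => circleTransfer A B θ * Φ θ * (circleTransfer A B θ)ᴴ := rfl

/-- A matrix in the range of `Γ` has a displacement of the form `B K₁ + K₂ B'`. -/
lemma exists_displacement (hA : IsStable A) {S : Matrix (Fin n) (Fin n) ℝ}
    (hS : S ∈ rangeGam A B) :
    ∃ (K₁ : Matrix (Fin m) (Fin n) ℂ) (K₂ : Matrix (Fin n) (Fin m) ℂ),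
      toC S - toC A * toC S * (toC A)ᴴ =
        toC B * K₁ + K₂ * (toC B)ᴴ := by
  obtain ⟨-, Φ, hΦ, hΦS⟩ := hS
  rw [Gam_eq_matrixIntegral] at hΦS
  set a := toC A
  set b := toC B
  set G := circleTransfer A B with hGdef
  have hG : Continuous G := continuous_circleTransfer hA
  have hGH : Continuous fun θ => (G θ)ᴴ := hG.matrix_conjTranspose
  have hΦ' : EntryIntegrable Φ := hΦ
  have i1 : EntryIntegrable fun θ => G θ * Φ θ := hΦ'.continuous_mul hG
  have i2 : EntryIntegrable fun θ => G θ * Φ θ * (G θ)ᴴ := i1.mul_continuous hGH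
  have i3 : EntryIntegrable fun θ => Φ θ * (G θ)ᴴ - Φ θ * bᴴ :=
    (hΦ'.mul_continuous hGH).sub (hΦ'.mul_continuous continuous_const)
  -- From `w a G = G - b` and `|w| = 1`, the integrand of the displacement is `G Φ G* - (G - b) Φ (G
  -- - b)*`, that is `b Φ G* + G Φ b* - b Φ b*`. The last term is put into `K₁`; `Φ` need not be
  -- Hermitian, so `K₂` need not be `K₁*`.
  refine ⟨matrixIntegral fun θ => Φ θ * (G θ)ᴴ - Φ θ * bᴴ, matrixIntegral fun θ => G θ * Φ θ, ?_⟩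
  have ia : EntryIntegrable fun θ => a * (G θ * Φ θ * (G θ)ᴴ) :=
    (EntryIntegrable.continuous_mul continuous_const i2)
  rw [← matrixIntegral_const_mul _ i3, ← matrixIntegral_mul_const i1,
    ← matrixIntegral_add (EntryIntegrable.continuous_mul continuous_const i3)
      (i1.mul_continuous continuous_const), ← hΦS, ← matrixIntegral_const_mul _ i2,
    ← matrixIntegral_mul_const ia,
    ← matrixIntegral_sub i2 (ia.mul_continuous continuous_const)]
  congr 1
  funext θ
  set w := (Complex.exp (θ * Complex.I))⁻¹ with hw
  have hww : w * star w = 1 := by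
    rw [RCLike.star_def, Complex.mul_conj, Complex.normSq_eq_norm_sq, norm_exp_inv]; simp
  have h1 : (1 - w • a) * G θ = b :=
    one_sub_smul_mul_transfer hA (Complex.norm_exp_ofReal_mul_I θ).ge
  have h2 : w • a * G θ = G θ - b := by
    rw [← h1, Matrix.sub_mul, Matrix.one_mul, sub_sub_cancel]
  have h3 : a * (G θ * Φ θ * (G θ)ᴴ) * aᴴ = (w • a * G θ) * Φ θ * (w • a * G θ)ᴴ := by
    rw [conjTranspose_mul, conjTranspose_smul, Matrix.mul_smul, Matrix.smul_mul, Matrix.smul_mul,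
      Matrix.smul_mul, Matrix.mul_smul, smul_smul, hww, one_smul]
    simp only [Matrix.mul_assoc]
  rw [h3, h2, conjTranspose_sub, Matrix.mul_sub, Matrix.sub_mul, Matrix.sub_mul, Matrix.sub_mul,
    Matrix.mul_sub]
  simp only [Matrix.mul_assoc]
  abel

end Transfer

/-! ### Spectral factorization and feasibility of the candidate -/

section SpectralFactor

variable {n m : ℕ} {A : Matrix (Fin n) (Fin n) ℝ} {B : Matrix (Fin n) (Fin m) ℝ}
  {S : Matrix (Fin n) (Fin n) ℝ}

lemma posDef_input (hB : B.rank = m) (hS : S.PosDef) :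
    ((toC B)ᴴ * (toC S)⁻¹ * toC B).PosDef := by
  have h := toC_posDef (hS.inv.conjTranspose_mul_mul_same (mulVec_injective_of_rank hB))
  rwa [conjTranspose_eq_transpose_of_trivial, toC_mul, toC_mul, toC_transpose,
    toC_inv hS.isUnit] at h

lemma toC_lamHat (hB : B.rank = m) (hS : S.PosDef) :
    toC (lamHat B S) = (toC S)⁻¹ * toC B * ((toC B)ᴴ * (toC S)⁻¹ * toC B)⁻¹ * (toC B)ᴴ *
      (toC S)⁻¹ := by
  have h : IsUnit (B.transpose * S⁻¹ * B) := by
    have := (hS.inv.conjTranspose_mul_mul_same (mulVec_injective_of_rank hB)).isUnit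
    rwa [conjTranspose_eq_transpose_of_trivial] at this
  rw [lamHat, toC_mul, toC_mul, toC_mul, toC_mul, toC_inv h, toC_mul, toC_mul, toC_transpose,
    toC_inv hS.isUnit]

/-- The denominator `B' S⁻¹ G(z)` of the spectral factor. -/
def denominator (A : Matrix (Fin n) (Fin n) ℝ) (B : Matrix (Fin n) (Fin m) ℝ)
    (S : Matrix (Fin n) (Fin n) ℝ) (z : ℂ) : Matrix (Fin m) (Fin m) ℂ :=
  (toC B)ᴴ * (toC S)⁻¹ * transfer A B z

/-- Since `z⁻¹ A G = G - B` and the projection `P` kills `B`, `z⁻¹ P A G = P G`; what is left of `G`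
is `(I - P) G`. -/
lemma one_sub_smul_closedLoop_mul_transfer (hA : IsStable A) (hB : B.rank = m) (hS : S.PosDef)
    {z : ℂ} (hz : 1 ≤ ‖z‖) :
    (1 - z⁻¹ • closedLoop (toC A) (toC B) (toC S)) * transfer A B z =
      toC B * ((toC B)ᴴ * (toC S)⁻¹ * toC B)⁻¹ * denominator A B S z := by
  have hP := one_sub_mul_input_eq_zero (posDef_input hB hS)
  have h1 := one_sub_smul_mul_transfer (B := B) hA hz
  have h2 : z⁻¹ • (toC A * transfer A B z) = transfer A B z - toC B := by
    rw [← h1, Matrix.sub_mul, Matrix.one_mul, sub_sub_cancel, Matrix.smul_mul]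
  rw [Matrix.sub_mul, Matrix.one_mul, closedLoop, Matrix.smul_mul, Matrix.mul_assoc _ (toC A),
    ← Matrix.mul_smul, h2, Matrix.mul_sub, hP, sub_zero, Matrix.sub_mul, Matrix.one_mul,
    sub_sub_cancel, denominator]
  simp only [Matrix.mul_assoc]

lemma lyapunov_and_stable_closedLoop (hA : IsStable A) (hB : B.rank = m) (hS : S.PosDef)
    (hSr : S ∈ rangeGam A B) :
    toC S - closedLoop (toC A) (toC B) (toC S) * toC S *
        (closedLoop (toC A) (toC B) (toC S))ᴴ =
      toC B * ((toC B)ᴴ * (toC S)⁻¹ * toC B)⁻¹ * (toC B)ᴴ ∧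
    ∀ z ∈ spectrum ℂ (closedLoop (toC A) (toC B) (toC S)), ‖z‖ < 1 := by
  obtain ⟨K₁, K₂, h⟩ := exists_displacement hA hSr
  have hM := posDef_input hB hS
  have hlyap := lyapunov_closedLoop (toC_posDef hS) hM h
  exact ⟨hlyap, stable_closedLoop (toC_posDef hS) hM hA hlyap⟩

/-- The spectral factor has minimum phase. -/
lemma isUnit_denominator (hA : IsStable A) (hB : B.rank = m) (hS : S.PosDef)
    (hSr : S ∈ rangeGam A B) {z : ℂ} (hz : 1 ≤ ‖z‖) : IsUnit (denominator A B S z) := by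
  have hc := (lyapunov_and_stable_closedLoop hA hB hS hSr).2
  have hu := (Matrix.isUnit_iff_isUnit_det _).1 (isUnit_one_sub_smul hc (norm_inv_le_one hz))
  have hM := posDef_input hB hS
  -- The left inverse recovers `G` from `B M⁻¹ C` by the closed-loop resolvent, then `B` from `G` by
  -- `I - z⁻¹ A`, and finally uses `M⁻¹ B* Σ⁻¹ B = I`.
  refine IsUnit.of_mul_eq_one_right
    (((toC B)ᴴ * (toC S)⁻¹ * toC B)⁻¹ * (toC B)ᴴ * (toC S)⁻¹ * (1 - z⁻¹ • toC A) *
      (1 - z⁻¹ • closedLoop (toC A) (toC B) (toC S))⁻¹ * toC B *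
      ((toC B)ᴴ * (toC S)⁻¹ * toC B)⁻¹) ?_
  rw [Matrix.mul_assoc, Matrix.mul_assoc, ← Matrix.mul_assoc (toC B),
    ← one_sub_smul_closedLoop_mul_transfer hA hB hS hz, ← Matrix.mul_assoc, Matrix.mul_assoc _ _⁻¹,
    nonsing_inv_mul _ hu, Matrix.mul_one, Matrix.mul_assoc, one_sub_smul_mul_transfer hA hz,
    Matrix.mul_assoc, Matrix.mul_assoc, ← Matrix.mul_assoc (toC B)ᴴ,
    nonsing_inv_mul _ ((Matrix.isUnit_iff_isUnit_det _).1 hM.isUnit)]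

lemma one_le_norm_exp (θ : ℝ) : 1 ≤ ‖Complex.exp (θ * Complex.I)‖ :=
  (Complex.norm_exp_ofReal_mul_I θ).ge

/-- This exhibits the factorization `C⁻¹ M C⁻*`, once `C` is known to be invertible. -/
lemma phiHat_eq (hB : B.rank = m) (hS : S.PosDef) (θ : ℝ) :
    phiHat A B S θ = ((denominator A B S (Complex.exp (θ * Complex.I)))ᴴ *
      ((toC B)ᴴ * (toC S)⁻¹ * toC B)⁻¹ * denominator A B S (Complex.exp (θ * Complex.I)))⁻¹ := by
  rw [phiHat, invQuad, toC_lamHat hB hS, denominator, circleTransfer, conjTranspose_mul,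
    conjTranspose_mul, conjTranspose_conjTranspose, (toC_posDef hS).inv.1.eq]
  simp only [Matrix.mul_assoc]

lemma phiHat_posDef (hA : IsStable A) (hB : B.rank = m) (hS : S.PosDef)
    (hSr : S ∈ rangeGam A B) (θ : ℝ) : (phiHat A B S θ).PosDef := by
  rw [phiHat_eq hB hS]
  exact ((posDef_input hB hS).inv.conjTranspose_mul_mul_same
    (mulVec_injective_of_isUnit (isUnit_denominator hA hB hS hSr (one_le_norm_exp θ)))).inv

lemma continuous_phiHat (hA : IsStable A) (hB : B.rank = m) (hS : S.PosDef)
    (hSr : S ∈ rangeGam A B) : Continuous (phiHat A B S) := by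
  have hG := continuous_circleTransfer (B := B) hA
  refine continuous_inv_of_det_ne_zero
    ((hG.matrix_conjTranspose.matrix_mul continuous_const).matrix_mul hG) fun θ => ?_
  -- A singular matrix has no invertible `⁻¹`, so positivity of the value shows that `G* Λ̂ G` is
  -- nonsingular.
  have h := (phiHat_posDef hA hB hS hSr θ).isUnit
  rw [phiHat, invQuad, Matrix.isUnit_nonsing_inv_iff, Matrix.isUnit_iff_isUnit_det] at h
  exact h.ne_zero

lemma isSpectralDensity_phiHat (hA : IsStable A) (hB : B.rank = m) (hS : S.PosDef)
    (hSr : S ∈ rangeGam A B) : IsSpectralDensity (phiHat A B S) where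
  integrable := entryIntegrable_of_continuous (continuous_phiHat hA hB hS hSr)
  posDef := .of_forall (phiHat_posDef hA hB hS hSr)
  entropy := by
    have h : Continuous fun θ => Real.log (phiHat A B S θ).det.re :=
      (Complex.continuous_re.comp (continuous_phiHat hA hB hS hSr).matrix_det).log fun θ =>
        (Complex.pos_iff.1 (phiHat_posDef hA hB hS hSr θ).det_pos).1.ne'
    obtain ⟨C, hC⟩ := exists_ae_norm_le (Complex.continuous_ofReal.comp h)
    exact .of_bound h.aestronglyMeasurable C (by simpa using hC)

lemma Gam_phiHat (hA : IsStable A) (hB : B.rank = m) (hS : S.PosDef)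
    (hSr : S ∈ rangeGam A B) : Gam A B (phiHat A B S) = toC S := by
  obtain ⟨hlyap, hc⟩ := lyapunov_and_stable_closedLoop hA hB hS hSr
  rw [← matrixIntegral_resolventCircle_lyapunov hc hlyap, Gam_eq_matrixIntegral]
  congr 1
  funext θ
  set z := Complex.exp (θ * Complex.I) with hz
  have hz1 : 1 ≤ ‖z‖ := one_le_norm_exp θ
  set M := (toC B)ᴴ * (toC S)⁻¹ * toC B with hMdef
  set C := denominator A B S z with hCdef
  set W := resolventCircle (closedLoop (toC A) (toC B) (toC S)) θ with hW
  have hM : M.PosDef := posDef_input hB hS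
  have hMu := (Matrix.isUnit_iff_isUnit_det _).1 hM.isUnit
  have hC : IsUnit C := isUnit_denominator hA hB hS hSr hz1
  have hCu := (Matrix.isUnit_iff_isUnit_det _).1 hC
  have hCHu : IsUnit Cᴴ.det := by rw [det_conjTranspose]; exact hCu.star
  have hu := (Matrix.isUnit_iff_isUnit_det _).1 (isUnit_one_sub_smul hc (norm_inv_le_one hz1))
  -- Factoring `C` out of `G` on the right lets it cancel against `C⁻¹ M C⁻*`, leaving the Lyapunov
  -- integrand.
  have hG : circleTransfer A B θ = W * toC B * M⁻¹ * C := by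
    have h := one_sub_smul_closedLoop_mul_transfer hA hB hS hz1
    rw [Matrix.mul_assoc, Matrix.mul_assoc, ← Matrix.mul_assoc (toC B), ← h, hW, resolventCircle,
      ← Matrix.mul_assoc, nonsing_inv_mul _ hu, Matrix.one_mul, circleTransfer]
  have hφ : C * phiHat A B S θ * Cᴴ = M := by
    rw [phiHat_eq hB hS, Matrix.mul_inv_rev, Matrix.mul_inv_rev, nonsing_inv_nonsing_inv _ hMu,
      ← Matrix.mul_assoc, mul_nonsing_inv _ hCu, Matrix.one_mul, Matrix.mul_assoc,
      nonsing_inv_mul _ hCHu, Matrix.mul_one]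
  calc circleTransfer A B θ * phiHat A B S θ * (circleTransfer A B θ)ᴴ
      = W * toC B * M⁻¹ * (C * phiHat A B S θ * Cᴴ) * (M⁻¹ * ((toC B)ᴴ * Wᴴ)) := by
        rw [hG, conjTranspose_mul, conjTranspose_mul, conjTranspose_mul, hM.inv.1.eq]
        simp only [Matrix.mul_assoc]
    _ = W * (toC B * M⁻¹ * (toC B)ᴴ) * Wᴴ := by
        rw [hφ, Matrix.mul_assoc _ M⁻¹ M, nonsing_inv_mul _ hMu, Matrix.mul_one]
        simp only [Matrix.mul_assoc]

lemma phiHat_mem_feasible (hA : IsStable A) (hB : B.rank = m) (hS : S.PosDef)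
    (hSr : S ∈ rangeGam A B) : phiHat A B S ∈ feasible A B S :=
  ⟨isSpectralDensity_phiHat hA hB hS hSr, Gam_phiHat hA hB hS hSr⟩

lemma map_conj_eq {k l : ℕ} (M : Matrix (Fin k) (Fin l) ℂ) :
    M.map (starRingEnd ℂ) = Mᴴᵀ := rfl

lemma map_conj_inv {k : ℕ} (M : Matrix (Fin k) (Fin k) ℂ) :
    M⁻¹.map (starRingEnd ℂ) = (M.map (starRingEnd ℂ))⁻¹ := by
  rw [map_conj_eq, map_conj_eq, conjTranspose_nonsing_inv, transpose_nonsing_inv]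

lemma circleTransfer_neg (θ : ℝ) :
    circleTransfer A B (-θ) = (circleTransfer A B θ).map (starRingEnd ℂ) := by
  have hz : Complex.exp (((-θ : ℝ) : ℂ) * Complex.I) =
      starRingEnd ℂ (Complex.exp (θ * Complex.I)) := by
    rw [← Complex.exp_conj]; simp
  have hmap : ∀ z : ℂ, (z • (1 : Matrix (Fin n) (Fin n) ℂ) - toC A).map (starRingEnd ℂ) =
      starRingEnd ℂ z • (1 : Matrix (Fin n) (Fin n) ℂ) - toC A := fun z => by
    ext i j
    by_cases h : i = j <;> simp [h]
  rw [circleTransfer, circleTransfer, hz, transfer, transfer, ← hmap, ← map_conj_inv]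
  ext i j
  simp [mul_apply]

/-- All coefficients are real, so reflecting the angle conjugates `G`, and entrywise conjugation
commutes with products and inverses. -/
lemma hasRealSymmetry_phiHat : HasRealSymmetry (phiHat A B S) := fun θ => by
  simp only [phiHat, invQuad]
  rw [circleTransfer_neg, map_conj_inv, Matrix.map_mul, Matrix.map_mul, toC_map_conj]
  rfl

end SpectralFactor

/-! ### Reduction to maximum entropy -/

section Optimality

variable {n m : ℕ} {A : Matrix (Fin n) (Fin n) ℝ} {B : Matrix (Fin n) (Fin m) ℝ}
  {S : Matrix (Fin n) (Fin n) ℝ}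

/-- Twice the integrand of the relative entropy, with `tr log` written as `log det`. -/
def divergence {m : ℕ} (Φ Ψ : CircleFun m) (θ : ℝ) : ℝ :=
  (Φ θ * (Ψ θ)⁻¹).trace.re - Real.log (Φ θ).det.re + Real.log (Ψ θ).det.re - m

lemma divergence_ae_nonneg {Φ Ψ : CircleFun m} (hΦ : IsSpectralDensity Φ)
    (hΨ : IsSpectralDensity Ψ) : 0 ≤ᵐ[circleMeasure] divergence Φ Ψ := by
  filter_upwards [hΦ.posDef, hΨ.posDef] with θ h1 h2
  simpa [divergence] using (divergence_nonneg h1 h2).1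

/-- Against a prior `(G* L G)⁻¹`, the divergence of a feasible density is integrable and its
integral depends on the density only through the entropy rate. -/
lemma integral_divergence (hA : IsStable A) {L : Matrix (Fin n) (Fin n) ℂ}
    (hL : IsSpectralDensity (invQuad A B L)) {Φ : CircleFun m} (hΦ : Φ ∈ feasible A B S) :
    Integrable (divergence Φ (invQuad A B L)) circleMeasure ∧
      ∫ θ, divergence Φ (invQuad A B L) θ ∂circleMeasure =
        (L * toC S).trace.re - entropyRate Φ + entropyRate (invQuad A B L) - m := by
  obtain ⟨hΦd, hΦS⟩ := hΦ
  have hG := continuous_circleTransfer (B := B) hA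
  have i1 : EntryIntegrable fun θ =>
      circleTransfer A B θ * Φ θ * (circleTransfer A B θ)ᴴ :=
    (EntryIntegrable.continuous_mul hG hΦd.integrable).mul_continuous hG.matrix_conjTranspose
  have i2 : EntryIntegrable fun θ =>
      L * (circleTransfer A B θ * Φ θ * (circleTransfer A B θ)ᴴ) :=
    EntryIntegrable.continuous_mul continuous_const i1
  -- Only where the prior is positive definite does inverting it return `G* L G`, hence an almost
  -- everywhere identity.
  have hae : (fun θ => (L * (circleTransfer A B θ * Φ θ * (circleTransfer A B θ)ᴴ)).trace)
      =ᵐ[circleMeasure] fun θ => (Φ θ * (invQuad A B L θ)⁻¹).trace := by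
    filter_upwards [hL.posDef] with θ hθ
    have hu := hθ.isUnit
    rw [invQuad, Matrix.isUnit_nonsing_inv_iff, Matrix.isUnit_iff_isUnit_det] at hu
    have e : L * (circleTransfer A B θ * Φ θ * (circleTransfer A B θ)ᴴ) =
        L * circleTransfer A B θ * (Φ θ * (circleTransfer A B θ)ᴴ) := by
      simp only [Matrix.mul_assoc]
    rw [invQuad, nonsing_inv_nonsing_inv _ hu, e, trace_mul_comm]
    simp only [Matrix.mul_assoc]
  have hint : Integrable (fun θ => (Φ θ * (invQuad A B L θ)⁻¹).trace) circleMeasure :=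
    i2.trace.congr hae
  have hval : ∫ θ, (Φ θ * (invQuad A B L θ)⁻¹).trace.re ∂circleMeasure =
      (L * toC S).trace.re := by
    rw [← hΦS, Gam_eq_matrixIntegral, ← matrixIntegral_const_mul _ i1, ← integral_trace i2,
      integral_congr_ae hae]
    exact integral_re hint
  have j1 := hint.re
  have j2 := j1.sub hΦd.entropy
  have j3 := j2.add hL.entropy
  refine ⟨j3.sub (integrable_const (m : ℝ)), ?_⟩
  have e1 := integral_sub j3 (integrable_const (m : ℝ))
  have e2 := integral_add j2 hL.entropy
  have e3 := integral_sub j1 hΦd.entropy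
  rw [integral_const, probReal_univ, one_smul] at e1
  refine e1.trans ?_
  rw [entropyRate, entropyRate, ← hval]
  congr 1
  exact e2.trans (congrArg (· + _) e3)

/-- Integrability of the nonnegative integrand turns the extended integral into a real one;
finiteness of the divergence comes from here. -/
lemma relEntropy_eq (hA : IsStable A) {L : Matrix (Fin n) (Fin n) ℂ}
    (hL : IsSpectralDensity (invQuad A B L)) {Φ : CircleFun m} (hΦ : Φ ∈ feasible A B S) :
    relEntropy Φ (invQuad A B L) = ENNReal.ofReal
      (1 / 2 * ∫ θ, divergence Φ (invQuad A B L) θ ∂circleMeasure) := by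
  have hnn := divergence_ae_nonneg hΦ.1 hL
  rw [← integral_const_mul, ofReal_integral_eq_lintegral_ofReal
    ((integral_divergence hA hL hΦ).1.const_mul _)
    (hnn.mono fun θ h => mul_nonneg (by norm_num) h), relEntropy]
  refine lintegral_congr_ae ?_
  filter_upwards [hΦ.1.posDef, hL.posDef] with θ h1 h2
  rw [trace_sub, trace_add, trace_sub, Complex.sub_re, Complex.add_re, Complex.sub_re,
    trace_matrixLog h1, trace_matrixLog h2, trace_one, Fintype.card_fin, Complex.natCast_re,
    divergence]

lemma integral_divergence_phiHat (hA : IsStable A) (hB : B.rank = m) (hS : S.PosDef)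
    (hSr : S ∈ rangeGam A B) {Φ : CircleFun m} (hΦ : Φ ∈ feasible A B S) :
    ∫ θ, divergence Φ (phiHat A B S) θ ∂circleMeasure =
      entropyRate (phiHat A B S) - entropyRate Φ := by
  have hd : IsSpectralDensity (invQuad A B (toC (lamHat B S))) :=
    isSpectralDensity_phiHat hA hB hS hSr
  have h1 := (integral_divergence hA hd hΦ).2
  -- Evaluating the formula at the candidate itself, where the divergence is zero, yields `tr (Λ̂ Σ)
  -- = m` without computation.
  have h2 := (integral_divergence hA hd (phiHat_mem_feasible hA hB hS hSr)).2
  have h3 : ∀ θ, divergence (phiHat A B S) (phiHat A B S) θ = 0 := fun θ => by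
    rw [divergence, mul_nonsing_inv _ ((Matrix.isUnit_iff_isUnit_det _).1
      (phiHat_posDef hA hB hS hSr θ).isUnit), trace_one, Fintype.card_fin, Complex.natCast_re]
    ring
  change ∫ θ, divergence (phiHat A B S) (phiHat A B S) θ ∂circleMeasure =
    _ - entropyRate (phiHat A B S) + entropyRate (phiHat A B S) - _ at h2
  change ∫ θ, divergence Φ (phiHat A B S) θ ∂circleMeasure =
    _ - entropyRate Φ + entropyRate (phiHat A B S) - _ at h1
  simp_rw [h3, integral_zero] at h2
  linarith

/-- `phiHat` has the largest entropy rate among the feasible densities. -/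
lemma entropyRate_le (hA : IsStable A) (hB : B.rank = m) (hS : S.PosDef)
    (hSr : S ∈ rangeGam A B) {Φ : CircleFun m} (hΦ : Φ ∈ feasible A B S) :
    entropyRate Φ ≤ entropyRate (phiHat A B S) := by
  have h := integral_nonneg_of_ae
    (divergence_ae_nonneg hΦ.1 (isSpectralDensity_phiHat hA hB hS hSr))
  rw [integral_divergence_phiHat hA hB hS hSr hΦ] at h
  linarith

lemma ae_eq_phiHat (hA : IsStable A) (hB : B.rank = m) (hS : S.PosDef)
    (hSr : S ∈ rangeGam A B) {Φ : CircleFun m} (hΦ : Φ ∈ feasible A B S)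
    (h : entropyRate (phiHat A B S) ≤ entropyRate Φ) : Φ =ᵐ[circleMeasure] phiHat A B S := by
  have hd := isSpectralDensity_phiHat hA hB hS hSr
  have h0 : ∫ θ, divergence Φ (phiHat A B S) θ ∂circleMeasure = 0 := by
    rw [integral_divergence_phiHat hA hB hS hSr hΦ]
    linarith [entropyRate_le hA hB hS hSr hΦ]
  rw [integral_eq_zero_iff_of_nonneg_ae (divergence_ae_nonneg hΦ.1 hd)
    (integral_divergence (L := toC (lamHat B S)) hA hd hΦ).1] at h0
  filter_upwards [h0, hΦ.1.posDef, hd.posDef] with θ h1 h2 h3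
  exact (divergence_nonneg h2 h3).2 (by simpa [divergence] using h1)

lemma relEntropy_le_iff (hA : IsStable A) {L : Matrix (Fin n) (Fin n) ℂ}
    (hL : IsSpectralDensity (invQuad A B L)) {Φ Φ' : CircleFun m} (hΦ : Φ ∈ feasible A B S)
    (hΦ' : Φ' ∈ feasible A B S) :
    relEntropy Φ (invQuad A B L) ≤ relEntropy Φ' (invQuad A B L) ↔
      entropyRate Φ' ≤ entropyRate Φ := by
  -- `ENNReal.ofReal` truncates at zero, so it reflects the order only when the right-hand value is
  -- nonnegative.
  have hnn := integral_nonneg_of_ae (divergence_ae_nonneg hΦ'.1 hL)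
  rw [relEntropy_eq hA hL hΦ, relEntropy_eq hA hL hΦ',
    ENNReal.ofReal_le_ofReal_iff (by positivity), (integral_divergence hA hL hΦ).2,
    (integral_divergence hA hL hΦ').2]
  constructor <;> intro h <;> linarith

end Optimality

/-! ### The Fourier filter bank -/

section Autoregressive

variable {n : ℕ} {A : Matrix (Fin (n + 1)) (Fin (n + 1)) ℝ} {B : Matrix (Fin (n + 1)) (Fin 1) ℝ}
  {S : Matrix (Fin (n + 1)) (Fin (n + 1)) ℝ}

lemma transfer_of_isFourier (hA : IsStable A) (hF : IsFourier A B) {z : ℂ} (hz : 1 ≤ ‖z‖) :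
    transfer A B z = Matrix.of fun (k : Fin (n + 1)) (_ : Fin 1) => (z ^ (k : ℕ))⁻¹ := by
  have hu := (Matrix.isUnit_iff_isUnit_det _).1 (isUnit_one_sub_smul hA (norm_inv_le_one hz))
  have h : (1 - z⁻¹ • toC A) * (Matrix.of fun (k : Fin (n + 1)) (_ : Fin 1) => (z ^ (k : ℕ))⁻¹) =
      toC B := by
    rw [Matrix.sub_mul, Matrix.one_mul, Matrix.smul_mul]
    ext i c
    rw [Matrix.sub_apply, Matrix.smul_apply, mul_apply]
    simp only [toC, map_apply, of_apply, hF.2.1, hF.2.2, smul_eq_mul]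
    -- Row `0` of the shift vanishes and leaves the input; row `i + 1` selects `z⁻ⁱ`, and the factor
    -- `z⁻¹` makes the difference zero.
    refine Fin.cases ?_ (fun i => ?_) i
    · simp
    · rw [Finset.sum_eq_single i.castSucc]
      · simp [pow_succ]
      · intro j _ hj
        rw [if_neg]
        · simp
        · intro h
          exact hj (Fin.ext (by simpa using h.symm))
      · simp
  rw [transfer_eq hA hz, ← h, ← Matrix.mul_assoc, nonsing_inv_mul _ hu, Matrix.one_mul]

lemma denominator_of_isFourier (hA : IsStable A) (hS : S.PosDef) (hF : IsFourier A B) {z : ℂ}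
    (hz : 1 ≤ ‖z‖) :
    denominator A B S z 0 0 = ∑ k : Fin (n + 1), (S⁻¹ 0 k : ℂ) * (z ^ (k : ℕ))⁻¹ := by
  rw [denominator, transfer_of_isFourier hA hF hz, mul_apply, ← toC_inv hS.isUnit]
  refine Finset.sum_congr rfl fun k _ => ?_
  congr 1
  rw [mul_apply, Finset.sum_eq_single 0]
  · simp [hF.2.2]
  · intro j _ hj
    have : (j : ℕ) ≠ 0 := fun h => hj (Fin.ext h)
    simp [hF.2.2, this]
  · simp

lemma input_of_isFourier (hS : S.PosDef) (hF : IsFourier A B) :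
    ((toC B)ᴴ * (toC S)⁻¹ * toC B) 0 0 = (S⁻¹ 0 0 : ℂ) := by
  have hz : ∀ j : Fin (n + 1), j ≠ 0 → B j 0 = 0 := fun j hj => by
    have : (j : ℕ) ≠ 0 := fun h => hj (Fin.ext h)
    simp [hF.2.2, this]
  have h1 : B 0 0 = 1 := by simp [hF.2.2]
  rw [← toC_inv hS.isUnit, mul_apply, Finset.sum_eq_single 0, mul_apply, Finset.sum_eq_single 0]
  · simp [h1]
  · intro j _ hj; simp [hz j hj]
  · simp
  · intro j _ hj; simp [hz j hj]
  · simp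

lemma inv_apply_fin_one (X : Matrix (Fin 1) (Fin 1) ℂ) : X⁻¹ 0 0 = (X 0 0)⁻¹ := by
  simp

lemma isAutoregressive_phiHat (hA : IsStable A) (hB : B.rank = 1) (hS : S.PosDef)
    (hSr : S ∈ rangeGam A B) (hF : IsFourier A B) : IsAutoregressive (n + 1) (phiHat A B S) := by
  have hμ : 0 < S⁻¹ 0 0 := hS.inv.diag_pos
  have hμ' : (S⁻¹ 0 0 : ℂ) ≠ 0 := by exact_mod_cast hμ.ne'
  -- The coefficients are the first row of `Σ⁻¹`, scaled so that `a 0 = 1`. With `μ = S⁻¹ 0 0`, both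
  -- `M = μ` and `C = μ q`, so `Φ̂ = μ⁻¹ / |q|²`; the value beyond `n` is never summed.
  set a : ℕ → ℝ := fun k => if h : k < n + 1 then S⁻¹ 0 ⟨k, h⟩ / S⁻¹ 0 0 else 0 with ha
  have hden : ∀ z : ℂ, 1 ≤ ‖z‖ → denominator A B S z 0 0 =
      S⁻¹ 0 0 * ∑ k ∈ Finset.range (n + 1), (a k : ℂ) * (z ^ k)⁻¹ := fun z hz => by
    rw [denominator_of_isFourier hA hS hF hz, Finset.sum_range, Finset.mul_sum]
    refine Finset.sum_congr rfl fun k _ => ?_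
    simp only [ha, k.2, dif_pos, Fin.eta, Complex.ofReal_div]
    field_simp
  refine ⟨(S⁻¹ 0 0)⁻¹, a, inv_pos.2 hμ, ?_, fun z hz h => ?_, fun θ i j => ?_⟩
  · simp only [ha, Nat.succ_pos, dif_pos]
    exact div_self hμ.ne'
  · have hu := (Matrix.isUnit_iff_isUnit_det _).1 (isUnit_denominator hA hB hS hSr hz)
    rw [det_fin_one, hden z hz, h, mul_zero] at hu
    exact not_isUnit_zero hu
  · rw [Subsingleton.elim i 0, Subsingleton.elim j 0, phiHat_eq hB hS, inv_apply_fin_one]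
    simp only [mul_apply, Fin.sum_univ_one, conjTranspose_apply, inv_apply_fin_one]
    have hin := input_of_isFourier (A := A) hS hF
    simp only [mul_apply, conjTranspose_apply] at hin
    rw [hin, hden _ (one_le_norm_exp θ)]
    set q := ∑ k ∈ Finset.range (n + 1), (a k : ℂ) * (Complex.exp (θ * Complex.I) ^ k)⁻¹
    have hq : star q * q = ((‖q‖ ^ 2 : ℝ) : ℂ) := by
      rw [mul_comm, RCLike.star_def, Complex.mul_conj, Complex.normSq_eq_norm_sq]
    rw [star_mul', RCLike.star_def, Complex.conj_ofReal, ← RCLike.star_def,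
      show (S⁻¹ 0 0 : ℂ) * star q * (S⁻¹ 0 0 : ℂ)⁻¹ * (S⁻¹ 0 0 * q) =
        (S⁻¹ 0 0 : ℂ) * (star q * q) by field_simp, hq]
    push_cast
    rw [mul_inv, div_eq_mul_inv]

end Autoregressive

end SpectralMoment

end

open SpectralMoment in
theorem theorem2 {n m : ℕ} (A : Matrix (Fin n) (Fin n) ℝ) (B : Matrix (Fin n) (Fin m) ℝ)
    (hA : IsStable A) (hAB : IsReachable A B) (hB : B.rank = m)
    (S : Matrix (Fin n) (Fin n) ℝ) (hS : S.PosDef) (hSr : S ∈ rangeGam A B) :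
    phiHat A B S ∈ feasible A B S ∧ HasRealSymmetry (phiHat A B S) ∧
    (∀ L₀ : Matrix (Fin n) (Fin n) ℂ, IsSpectralDensity (invQuad A B L₀) →
      phiHat A B S ∈ solutions A B S (invQuad A B L₀) ∧
      relEntropy (phiHat A B S) (invQuad A B L₀) < ⊤ ∧
      ∀ Φ ∈ solutions A B S (invQuad A B L₀), Φ =ᵐ[circleMeasure] phiHat A B S) ∧
    (IsFourier A B →
      IsAutoregressive n (phiHat A B S) ∧
      IsMaxOn entropyRate (feasible A B S) (phiHat A B S) ∧
      ∀ Φ ∈ feasible A B S, IsMaxOn entropyRate (feasible A B S) Φ →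
        Φ =ᵐ[circleMeasure] phiHat A B S) := by
  have hf := phiHat_mem_feasible hA hB hS hSr
  refine ⟨hf, hasRealSymmetry_phiHat, fun L₀ hL => ⟨⟨hf, fun Φ hΦ => ?_⟩, ?_, fun Φ hΦ => ?_⟩,
    fun hF => ⟨?_, fun Φ hΦ => entropyRate_le hA hB hS hSr hΦ, fun Φ hΦ hmax =>
      ae_eq_phiHat hA hB hS hSr hΦ (hmax hf)⟩⟩
  · exact (relEntropy_le_iff hA hL hf hΦ).2 (entropyRate_le hA hB hS hSr hΦ)
  · rw [relEntropy_eq hA hL hf]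
    exact ENNReal.ofReal_lt_top
  · exact ae_eq_phiHat hA hB hS hSr hΦ.1 ((relEntropy_le_iff hA hL hΦ.1 hf).1 (hΦ.2 hf))
  · obtain rfl := hF.1
    cases n with
    -- A matrix without rows cannot have rank one.
    | zero => exact absurd (B.rank_le_height) (by omega)
    | succ n => exact isAutoregressive_phiHat hA hB hS hSr hF
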